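/- Let $a$ and $b$ be relatively prime integers with $b\neq 0$, and define the first and second Lucas sequences by $U_0=0$, $U_1=1$, $U_{k+2}=aU_{k+1}+bU_k$ and $V_0=2$, $V_1=a$, $V_{k+2}=aV_{k+1}+bV_k$ for $k\ge 0$. For a positive integer $m$ relatively prime to $b$, let $\tau(m)=\min\{k\ge 1 : m\mid U_k\}$ be the order of appearance of $m$ in $(U_k)_{k\ge0}$. Suppose that $a>0$ and $\Delta=a^2+4b>0$. Then for every positive integer $n$ and every prime $p\ge 3$, the integer $U_nU_{n+p}U_{n+2p}$ is positive and relatively prime to $b$, its order of appearance exists, and \[ \tau(U_nU_{n+p}U_{n+2p})= \begin{cases} n(n+p)(n+2p), & \text{if } p\nmid n \text{ and } 2\nmid n,\\[4pt] \dfrac{n(n+p)(n+2p)}{2}\cdot\dfrac{a}{\gcd(a,\,n+p)}, & \text{if } p\nmid n \text{ and } 2\mid n,\\[8pt] \dfrac{n(n+p)(n+2p)}{p^2}\,U_p^2, & \text{if } p\mid n \text{ and } 2\nmid n,\\[8pt] \dfrac{n(n+p)(n+2p)}{2p^2}\cdot\dfrac{U_p^2V_p}{\gcd\left(V_p,\,(n+p)/p\right)},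 & \text{if } p\mid n \text{ and } 2\mid n. \end{cases} \] -/

import Mathlib

/-- The first Lucas sequence `U_n(a, b)`: `U_0 = 0`, `U_1 = 1`, `U_{n+2} = a U_{n+1} + b U_n`. -/
def lucasU (a b : ℤ) : ℕ → ℤ
  | 0 => 0
  | 1 => 1
  | n + 2 => a * lucasU a b (n + 1) + b * lucasU a b n

/-- The second Lucas sequence `V_n(a, b)`: `V_0 = 2`, `V_1 = a`, `V_{n+2} = a V_{n+1} + b V_n`. -/
def lucasV (a b : ℤ) : ℕ → ℤ
  | 0 => 2
  | 1 => a
  | n + 2 => a * lucasV a b (n + 1) + b * lucasV a b n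

/-- The positive integers `k` with `m ∣ U_k(a, b)`. -/
def appearanceSet (a b m : ℤ) : Set ℕ :=
  {k : ℕ | 1 ≤ k ∧ m ∣ lucasU a b k}

/-- The order of appearance `τ(m)` of `m` in the sequence `U_n(a, b)`: the smallest positive
integer `k` with `m ∣ U_k`. It is meant for a positive integer `m` relatively prime to `b`; where
no such `k` exists the value is `0`, so it is positive exactly where the minimum exists. -/
noncomputable def orderOfAppearance (a b m : ℤ) : ℕ :=
  sInf (appearanceSet a b m)

theorem lucasU_add_two (a b : ℤ) (k : ℕ) :
    lucasU a b (k + 2) = a * lucasU a b (k + 1) + b * lucasU a b k := by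
  rw [lucasU]

theorem lucasV_add_two (a b : ℤ) (k : ℕ) :
    lucasV a b (k + 2) = a * lucasV a b (k + 1) + b * lucasV a b k := by
  rw [lucasV]

theorem lucasU_zero (a b : ℤ) : lucasU a b 0 = 0 := by rw [lucasU]

theorem lucasU_one (a b : ℤ) : lucasU a b 1 = 1 := by rw [lucasU]

theorem lucasU_two (a b : ℤ) : lucasU a b 2 = a := by
  rw [lucasU_add_two, lucasU_zero, lucasU_one]; ring

theorem lucasV_zero (a b : ℤ) : lucasV a b 0 = 2 := by rw [lucasV]

theorem lucasV_one (a b : ℤ) : lucasV a b 1 = a := by rw [lucasV]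

theorem lucasV_eq (a b : ℤ) (k : ℕ) :
    lucasV a b k = 2 * lucasU a b (k + 1) - a * lucasU a b k := by
  induction k using Nat.twoStepInduction with
  | zero => simp [lucasU_zero, lucasU_one, lucasV_zero]
  | one => simp [lucasU_two, lucasU_one, lucasV_one]; ring
  | more k h₁ h₂ =>
    rw [lucasV_add_two, h₁, h₂, lucasU_add_two a b (k + 1), lucasU_add_two a b k]
    ring

theorem two_mul_lucasU_succ (a b : ℤ) (k : ℕ) :
    2 * lucasU a b (k + 1) = a * lucasU a b k + lucasV a b k := by
  rw [lucasV_eq]; ring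

theorem two_mul_lucasV_succ (a b : ℤ) (k : ℕ) :
    2 * lucasV a b (k + 1) = a * lucasV a b k + (a ^ 2 + 4 * b) * lucasU a b k := by
  rw [lucasV_eq, lucasV_eq, lucasU_add_two]; ring

theorem two_mul_lucas_add (a b : ℤ) (s r : ℕ) :
    2 * lucasU a b (s + r) = lucasU a b s * lucasV a b r + lucasV a b s * lucasU a b r ∧
    2 * lucasV a b (s + r) =
      lucasV a b s * lucasV a b r + (a ^ 2 + 4 * b) * lucasU a b s * lucasU a b r := by
  induction r with
  | zero => simp [lucasU_zero, lucasV_zero, mul_comm]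
  | succ r ih =>
    obtain ⟨h₁, h₂⟩ := ih
    have e₁ := two_mul_lucasU_succ a b r
    have e₂ := two_mul_lucasV_succ a b r
    have f₁ := two_mul_lucasU_succ a b (s + r)
    have f₂ := two_mul_lucasV_succ a b (s + r)
    rw [← add_assoc]
    constructor
    · refine mul_left_cancel₀ (two_ne_zero (α := ℤ)) ?_
      linear_combination 2 * f₁ + a * h₁ + h₂ - lucasU a b s * e₂ - lucasV a b s * e₁
    · refine mul_left_cancel₀ (two_ne_zero (α := ℤ)) ?_
      linear_combination 2 * f₂ + a * h₂ + (a ^ 2 + 4 * b) * h₁ - lucasV a b s * e₂ -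
        (a ^ 2 + 4 * b) * lucasU a b s * e₁

theorem lucasV_sq (a b : ℤ) (k : ℕ) :
    lucasV a b k ^ 2 = (a ^ 2 + 4 * b) * lucasU a b k ^ 2 + 4 * (-b) ^ k := by
  induction k with
  | zero => simp [lucasU_zero, lucasV_zero]
  | succ k ih =>
    have e₁ := two_mul_lucasU_succ a b k
    have e₂ := two_mul_lucasV_succ a b k
    have : 4 * lucasV a b (k + 1) ^ 2 =
        4 * ((a ^ 2 + 4 * b) * lucasU a b (k + 1) ^ 2 + 4 * (-b) ^ (k + 1)) := by
      calc _ = (2 * lucasV a b (k + 1)) ^ 2 := by ring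
        _ = (a ^ 2 + 4 * b) * (2 * lucasU a b (k + 1)) ^ 2 + 16 * (-b) ^ (k + 1) := by
          rw [e₁, e₂, pow_succ]; linear_combination -4 * b * ih
        _ = _ := by ring
    linarith

theorem lucasU_two_mul (a b : ℤ) (r : ℕ) :
    lucasU a b (2 * r) = lucasU a b r * lucasV a b r := by
  have h := (two_mul_lucas_add a b r r).1
  rw [two_mul r]; linarith

theorem lucasV_two_mul (a b : ℤ) (r : ℕ) :
    lucasV a b (2 * r) = lucasV a b r ^ 2 - 2 * (-b) ^ r := by
  have h := (two_mul_lucas_add a b r r).2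
  have := lucasV_sq a b r
  rw [two_mul r]; linarith

theorem lucasU_add_two_mul (a b : ℤ) (s r : ℕ) :
    lucasU a b (s + r + r) =
      lucasV a b r * lucasU a b (s + r) - (-b) ^ r * lucasU a b s := by
  have h₁ := (two_mul_lucas_add a b s r)
  have h₂ := (two_mul_lucas_add a b (s + r) r)
  have h₃ := lucasV_sq a b r
  have : 4 * lucasU a b (s + r + r) =
      4 * (lucasV a b r * lucasU a b (s + r) - (-b) ^ r * lucasU a b s) := by
    linear_combination 2 * h₂.1 + lucasU a b r * h₁.2 - lucasV a b r * h₁.1 - lucasU a b s * h₃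
  linarith

theorem lucasU_mul (a b : ℤ) (r k : ℕ) :
    lucasU a b (r * k) = lucasU a b r * lucasU (lucasV a b r) (-(-b) ^ r) k := by
  induction k using Nat.twoStepInduction with
  | zero => simp [lucasU_zero]
  | one => simp [lucasU_one]
  | more k h₁ h₂ =>
    rw [lucasU_add_two, show r * (k + 2) = r * k + r + r by ring, lucasU_add_two_mul,
      show r * k + r = r * (k + 1) by ring, h₁, h₂]
    ring

theorem lucasU_dvd_of_dvd (a b : ℤ) {m n : ℕ} (h : m ∣ n) : lucasU a b m ∣ lucasU a b n := by
  obtain ⟨k, rfl⟩ := h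
  exact ⟨_, lucasU_mul a b m k⟩

theorem lucasU_add_succ (a b : ℤ) (m k : ℕ) :
    lucasU a b (m + k + 1) =
      lucasU a b (m + 1) * lucasU a b (k + 1) + b * lucasU a b m * lucasU a b k := by
  induction k using Nat.twoStepInduction with
  | zero => simp [lucasU_zero, lucasU_one]
  | one => simp [lucasU_zero, lucasU_one, lucasU_add_two]; ring
  | more k h₁ h₂ =>
    rw [show m + (k + 2) + 1 = (m + k + 1) + 2 by ring, lucasU_add_two,
      show m + k + 1 + 1 = m + (k + 1) + 1 by ring, h₁, h₂, lucasU_add_two a b (k + 1),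
      lucasU_add_two a b k]
    ring

theorem isCoprime_lucasU_succ {a b : ℤ} (hab : IsCoprime a b) (k : ℕ) :
    IsCoprime (lucasU a b (k + 1)) b := by
  induction k with
  | zero => simp [lucasU_one, isCoprime_one_left]
  | succ k ih =>
    rw [lucasU_add_two, mul_comm b]
    exact (hab.mul_left ih).add_mul_right_left _

theorem isCoprime_lucasU {a b : ℤ} (hab : IsCoprime a b) {k : ℕ} (hk : 0 < k) :
    IsCoprime (lucasU a b k) b := by
  obtain ⟨k, rfl⟩ := Nat.exists_eq_succ_of_ne_zero hk.ne'
  exact isCoprime_lucasU_succ hab k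

theorem isCoprime_lucasV {a b : ℤ} (hab : IsCoprime a b) {k : ℕ} (hk : 0 < k) :
    IsCoprime (lucasV a b k) b := by
  obtain ⟨k, rfl⟩ := Nat.exists_eq_succ_of_ne_zero hk.ne'
  induction k with
  | zero => simpa [lucasV_one] using hab
  | succ k ih =>
    rw [Nat.succ_eq_add_one, lucasV_add_two, mul_comm b]
    exact (hab.mul_left (ih (Nat.succ_pos _))).add_mul_right_left _

theorem isCoprime_lucasU_consecutive {a b : ℤ} (hab : IsCoprime a b) (k : ℕ) :
    IsCoprime (lucasU a b (k + 1)) (lucasU a b k) := by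
  induction k with
  | zero => simp [lucasU_one, isCoprime_one_left]
  | succ k ih =>
    rw [lucasU_add_two, add_comm, mul_comm a, mul_comm b]
    refine IsCoprime.add_mul_left_left ?_ _
    exact (ih.symm).mul_left (isCoprime_lucasU_succ hab k).symm

theorem dvd_lucasU_gcd {a b : ℤ} (hab : IsCoprime a b) {d : ℤ} (m n : ℕ)
    (hm : d ∣ lucasU a b m) (hn : d ∣ lucasU a b n) : d ∣ lucasU a b (m.gcd n) := by
  have step : ∀ m k : ℕ, d ∣ lucasU a b m → d ∣ lucasU a b (m + k) → d ∣ lucasU a b k := by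
    intro m k hm hmk
    rcases m with _ | m
    · simpa using hmk
    have h : lucasU a b (m + 1 + k) =
        lucasU a b (m + 1) * lucasU a b (k + 1) + b * lucasU a b m * lucasU a b k := by
      rw [← lucasU_add_succ]; congr 1; ring
    have h₁ : d ∣ b * lucasU a b m * lucasU a b k := by
      rw [h] at hmk
      exact (dvd_add_right (hm.mul_right _)).1 hmk
    refine IsCoprime.dvd_of_dvd_mul_left ?_ h₁
    exact IsCoprime.of_isCoprime_of_dvd_left
      ((isCoprime_lucasU_succ hab m).mul_right (isCoprime_lucasU_consecutive hab m)) hm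
  have hmod : ∀ q m r : ℕ, d ∣ lucasU a b m → d ∣ lucasU a b (m * q + r) → d ∣ lucasU a b r := by
    intro q m r hm h
    exact step (m * q) r (hm.trans (lucasU_dvd_of_dvd a b (dvd_mul_right m q))) h
  induction m, n using Nat.gcd.induction with
  | H0 n => simpa using hn
  | H1 m n _ ih =>
    rw [Nat.gcd_rec]
    refine ih (hmod (n / m) m _ hm ?_) hm
    rwa [Nat.div_add_mod]

theorem isCoprime_lucasU_of_coprime {a b : ℤ} (hab : IsCoprime a b) {m n : ℕ}
    (h : m.Coprime n) : IsCoprime (lucasU a b m) (lucasU a b n) := by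
  rw [Int.isCoprime_iff_gcd_eq_one]
  have := dvd_lucasU_gcd hab m n (Int.gcd_dvd_left (lucasU a b m) (lucasU a b n))
    (Int.gcd_dvd_right _ _)
  rw [h, lucasU_one] at this
  exact_mod_cast Int.eq_one_of_dvd_one (by positivity) this

theorem lucas_pos {a b : ℤ} (ha : 0 < a) (hΔ : 0 < a ^ 2 + 4 * b) (k : ℕ) :
    0 < lucasU a b (k + 1) ∧ 0 < lucasV a b (k + 1) := by
  induction k with
  | zero => simp [lucasU_one, lucasV_one, ha]
  | succ k ih =>
    have e₁ := two_mul_lucasU_succ a b (k + 1)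
    have e₂ := two_mul_lucasV_succ a b (k + 1)
    have := mul_pos ha ih.1
    have := mul_pos ha ih.2
    have := mul_pos hΔ ih.1
    constructor <;> linarith [ih.2]

theorem lucasU_pos {a b : ℤ} (ha : 0 < a) (hΔ : 0 < a ^ 2 + 4 * b) {k : ℕ} (hk : 0 < k) :
    0 < lucasU a b k := by
  obtain ⟨k, rfl⟩ := Nat.exists_eq_succ_of_ne_zero hk.ne'
  exact (lucas_pos ha hΔ k).1

theorem lucasV_pos {a b : ℤ} (ha : 0 < a) (hΔ : 0 < a ^ 2 + 4 * b) {k : ℕ} (hk : 0 < k) :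
    0 < lucasV a b k := by
  obtain ⟨k, rfl⟩ := Nat.exists_eq_succ_of_ne_zero hk.ne'
  exact (lucas_pos ha hΔ k).2

theorem one_lt_lucasV {a b : ℤ} (hb : b ≠ 0) (ha : 0 < a) (hΔ : 0 < a ^ 2 + 4 * b) {k : ℕ}
    (hk : 2 ≤ k) : 1 < lucasV a b k := by
  obtain ⟨k, rfl⟩ := Nat.exists_eq_add_of_le' hk
  rcases eq_or_lt_of_le (show 1 ≤ a from ha) with rfl | h1
  · rw [lucasV_add_two]
    have : 1 ≤ b := by omega
    have h₁ := lucasV_pos ha hΔ (Nat.succ_pos k)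
    have h₂ : 0 < lucasV 1 b k := by
      rcases Nat.eq_zero_or_pos k with rfl | h
      · simp [lucasV_zero]
      · exact lucasV_pos ha hΔ h
    have := mul_pos this h₂
    linarith
  · have key : ∀ j : ℕ, 1 < lucasV a b j := by
      intro j
      induction j with
      | zero => simp [lucasV_zero]
      | succ j ih =>
        rcases Nat.eq_zero_or_pos j with rfl | h
        · simpa [lucasV_one] using h1
        have e₂ := two_mul_lucasV_succ a b j
        have := mul_pos hΔ (lucasU_pos ha hΔ h)
        nlinarith
    exact key _

theorem lucasU_lt_succ {a b : ℤ} (hb : b ≠ 0) (ha : 0 < a) (hΔ : 0 < a ^ 2 + 4 * b) {k : ℕ}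
    (hk : 0 < k) (h : 1 < k ∨ 1 < a) : lucasU a b k < lucasU a b (k + 1) := by
  have hU := lucasU_pos ha hΔ hk
  rcases eq_or_lt_of_le (show 1 ≤ a from ha) with rfl | h1
  · obtain ⟨k, rfl⟩ := Nat.exists_eq_add_of_le' (show 2 ≤ k by omega)
    rw [show k + 2 + 1 = (k + 1) + 2 by ring, lucasU_add_two _ _ (k + 1)]
    have : 1 ≤ b := by omega
    have := mul_pos this (lucasU_pos ha hΔ (Nat.succ_pos k))
    simp only [Nat.succ_eq_add_one] at this
    rw [show k + 1 + 1 = k + 2 by ring]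
    linarith
  · have e₁ := two_mul_lucasU_succ a b k
    have := lucasV_pos ha hΔ hk
    nlinarith

theorem lucasU_le_succ {a b : ℤ} (hb : b ≠ 0) (ha : 0 < a) (hΔ : 0 < a ^ 2 + 4 * b) (k : ℕ) :
    lucasU a b k ≤ lucasU a b (k + 1) := by
  rcases Nat.lt_trichotomy k 1 with h | rfl | h
  · obtain rfl : k = 0 := by omega
    simp [lucasU_zero, lucasU_one]
  · rw [lucasU_one, lucasU_two]; exact ha
  · exact (lucasU_lt_succ hb ha hΔ (by omega) (Or.inl h)).le

theorem dvd_of_lucasU_dvd {a b : ℤ} (hab : IsCoprime a b) (hb : b ≠ 0) (ha : 0 < a)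
    (hΔ : 0 < a ^ 2 + 4 * b) {n k : ℕ} (hn : 0 < n) (h : n ≠ 2 ∨ 1 < a)
    (hnk : lucasU a b n ∣ lucasU a b k) : n ∣ k := by
  have hg := dvd_lucasU_gcd hab n k dvd_rfl hnk
  have hgpos : 0 < n.gcd k := Nat.gcd_pos_of_pos_left _ hn
  have hle := Int.le_of_dvd (lucasU_pos ha hΔ hgpos) hg
  have hgn : n.gcd k ≤ n := Nat.gcd_le_left _ hn
  rcases eq_or_lt_of_le hgn with h' | h'
  · rw [← h']; exact Nat.gcd_dvd_right _ _
  exfalso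
  obtain ⟨n, rfl⟩ := Nat.exists_eq_succ_of_ne_zero hn.ne'
  have h₁ : lucasU a b n < lucasU a b (n + 1) := lucasU_lt_succ hb ha hΔ (by omega) (by omega)
  have h₂ : lucasU a b ((n + 1).gcd k) ≤ lucasU a b n :=
    monotone_nat_of_le_succ (lucasU_le_succ hb ha hΔ) (Nat.lt_succ_iff.1 h')
  exact absurd (hle.trans h₂) (not_le.2 h₁)

theorem discrim_dvd_two_pow_mul_lucasV_sub (a b : ℤ) (k : ℕ) :
    a ^ 2 + 4 * b ∣ 2 ^ k * lucasV a b k - 2 * a ^ k := by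
  induction k with
  | zero => simp [lucasV_zero]
  | succ k ih =>
    obtain ⟨c, hc⟩ := ih
    refine ⟨a * c + 2 ^ k * lucasU a b k, ?_⟩
    have := two_mul_lucasV_succ a b k
    rw [pow_succ, pow_succ]
    linear_combination 2 ^ k * this + a * hc

theorem discrim_dvd_two_pow_mul_lucasU_sub (a b : ℤ) (k : ℕ) :
    a ^ 2 + 4 * b ∣ 2 ^ k * (2 * lucasU a b (k + 1)) - 2 * (k + 1) * a ^ k := by
  induction k with
  | zero => simp [lucasU_one]
  | succ k ih =>
    obtain ⟨c, hc⟩ := ih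
    obtain ⟨c', hc'⟩ := discrim_dvd_two_pow_mul_lucasV_sub a b (k + 1)
    refine ⟨a * c + c', ?_⟩
    have := two_mul_lucasU_succ a b (k + 1)
    push_cast
    rw [pow_succ] at *
    linear_combination 2 ^ k * 2 * this + a * hc + hc'

theorem discrim_lucasV (a b : ℤ) (r : ℕ) :
    lucasV a b r ^ 2 + 4 * (-(-b) ^ r) = (a ^ 2 + 4 * b) * lucasU a b r ^ 2 := by
  rw [lucasV_sq]; ring

theorem not_dvd_two_of_odd_prime {q : ℕ} (hq : q.Prime) (hq2 : q ≠ 2) : ¬ (q : ℤ) ∣ 2 := by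
  intro h
  have h' : q ∣ 2 := by exact_mod_cast h
  exact hq2 ((Nat.prime_dvd_prime_iff_eq hq Nat.prime_two).1 h')

theorem not_dvd_of_dvd_discrim {a b : ℤ} {q : ℕ} (hq : q.Prime) (hq2 : q ≠ 2)
    (hqb : ¬ (q : ℤ) ∣ b) (h : (q : ℤ) ∣ a ^ 2 + 4 * b) : ¬ (q : ℤ) ∣ a := by
  intro ha
  have hq' := Nat.prime_iff_prime_int.1 hq
  have h4 : (q : ℤ) ∣ 4 * b := (dvd_add_right (dvd_pow ha two_ne_zero)).1 h
  rw [show (4 : ℤ) * b = 2 * (2 * b) by ring] at h4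
  have h2 := not_dvd_two_of_odd_prime hq hq2
  rcases hq'.dvd_or_dvd h4 with h4 | h4
  · exact h2 h4
  rcases hq'.dvd_or_dvd h4 with h4 | h4
  · exact h2 h4
  · exact hqb h4

theorem not_dvd_lucasU_of_dvd_discrim {a b : ℤ} {q : ℕ} (hq : q.Prime) (hq2 : q ≠ 2)
    (hqb : ¬ (q : ℤ) ∣ b) (h : (q : ℤ) ∣ a ^ 2 + 4 * b) {k : ℕ} (hk : ¬ q ∣ k) :
    ¬ (q : ℤ) ∣ lucasU a b k := by
  intro hU
  have hq' := Nat.prime_iff_prime_int.1 hq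
  obtain ⟨k, rfl⟩ := Nat.exists_eq_succ_of_ne_zero (show k ≠ 0 by rintro rfl; simp at hk)
  have h₁ := h.trans (discrim_dvd_two_pow_mul_lucasU_sub a b k)
  have h₂ : (q : ℤ) ∣ 2 * (k + 1) * a ^ k :=
    (dvd_sub_right ((hU.mul_left 2).mul_left _)).1 h₁
  rcases hq'.dvd_or_dvd h₂ with h₂ | h₂
  · rcases hq'.dvd_or_dvd h₂ with h₂ | h₂
    · exact not_dvd_two_of_odd_prime hq hq2 h₂
    · exact hk (by exact_mod_cast h₂)
  · exact not_dvd_of_dvd_discrim hq hq2 hqb h (hq'.dvd_of_dvd_pow h₂)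

theorem padicValInt_lucasU_prime {a b : ℤ} {q : ℕ} (hq : q.Prime) (hq2 : q ≠ 2)
    (hqb : ¬ (q : ℤ) ∣ b) (h : (q : ℤ) ^ 2 ∣ a ^ 2 + 4 * b) (h0 : lucasU a b q ≠ 0) :
    padicValInt q (lucasU a b q) = 1 := by
  have := Fact.mk hq
  have hq' := Nat.prime_iff_prime_int.1 hq
  have h2 := not_dvd_two_of_odd_prime hq hq2
  have h1 : (q : ℤ) ∣ a ^ 2 + 4 * b := (dvd_pow_self _ two_ne_zero).trans h
  have hqa := not_dvd_of_dvd_discrim hq hq2 hqb h1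
  obtain ⟨k, hk⟩ := Nat.exists_eq_succ_of_ne_zero hq.ne_zero
  have hd := discrim_dvd_two_pow_mul_lucasU_sub a b k
  have hkq : (k : ℤ) + 1 = q := by rw [hk]; push_cast; ring
  rw [← Nat.succ_eq_add_one, ← hk, hkq] at hd
  have hdvd : (q : ℤ) ∣ lucasU a b q := by
    have h₂ : (q : ℤ) ∣ 2 ^ k * (2 * lucasU a b q) :=
      (dvd_sub_left (⟨2 * a ^ k, by ring⟩ : (q : ℤ) ∣ 2 * q * a ^ k)).1 (h1.trans hd)
    rcases hq'.dvd_or_dvd h₂ with h₂ | h₂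
    · exact absurd (hq'.dvd_of_dvd_pow h₂) h2
    · exact (hq'.dvd_or_dvd h₂).resolve_left h2
  have hndvd : ¬ (q : ℤ) ^ 2 ∣ lucasU a b q := by
    intro h₂
    have h₃ : (q : ℤ) ^ 2 ∣ 2 * q * a ^ k :=
      (dvd_sub_right ((h₂.mul_left 2).mul_left _)).1 (h.trans hd)
    rw [show 2 * (q : ℤ) * a ^ k = q * (2 * a ^ k) by ring, pow_two] at h₃
    rcases hq'.dvd_or_dvd (Int.dvd_of_mul_dvd_mul_left hq'.ne_zero h₃) with h₄ | h₄
    · exact h2 h₄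
    · exact hqa (hq'.dvd_of_dvd_pow h₄)
  have l1 : 1 ≤ padicValInt q (lucasU a b q) := by
    rcases (padicValInt_dvd_iff 1 (lucasU a b q)).1 (by simpa using hdvd) with h | h
    · exact absurd h h0
    · exact h
  have l2 : ¬ 2 ≤ padicValInt q (lucasU a b q) := fun h' =>
    hndvd ((padicValInt_dvd_iff 2 (lucasU a b q)).2 (Or.inr h'))
  omega

theorem padicValInt_lucasU_of_sq_dvd_discrim {a b : ℤ} {q : ℕ} (hq : q.Prime) (hq2 : q ≠ 2)
    (hqb : ¬ (q : ℤ) ∣ b) (ha : 0 < a) (hΔ : 0 < a ^ 2 + 4 * b)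
    (h : (q : ℤ) ^ 2 ∣ a ^ 2 + 4 * b) (k : ℕ) (hk : 0 < k) :
    padicValInt q (lucasU a b k) = padicValNat q k := by
  have := Fact.mk hq
  have hq' := Nat.prime_iff_prime_int.1 hq
  have h1 : (q : ℤ) ∣ a ^ 2 + 4 * b := (dvd_pow_self _ two_ne_zero).trans h
  induction k using Nat.strong_induction_on with
  | _ k ih =>
    by_cases hqk : q ∣ k
    · obtain ⟨j, rfl⟩ := hqk
      have hj : 0 < j := Nat.pos_of_mul_pos_left hk
      have hU := (lucasU_pos ha hΔ hj).ne'
      have hne : lucasU (lucasV a b j) (-(-b) ^ j) q ≠ 0 := by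
        intro h0
        have := (lucasU_pos ha hΔ hk).ne'
        rw [mul_comm, lucasU_mul, h0, mul_zero] at this
        exact this rfl
      have hb' : ¬ (q : ℤ) ∣ -(-b) ^ j := by
        rw [dvd_neg]
        intro h'
        exact hqb ((dvd_neg).1 (hq'.dvd_of_dvd_pow h'))
      rw [mul_comm q j, lucasU_mul, padicValInt.mul hU hne,
        padicValInt_lucasU_prime hq hq2 hb' (by rw [discrim_lucasV]; exact h.mul_right _) hne,
        ih j (by nlinarith [hq.two_le]) hj, padicValNat.mul hj.ne' hq.ne_zero, padicValNat_self]
    · rw [padicValNat.eq_zero_of_not_dvd hqk, padicValInt]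
      apply padicValNat.eq_zero_of_not_dvd
      rw [← Int.natCast_dvd]
      exact not_dvd_lucasU_of_dvd_discrim hq hq2 hqb h1 hqk

theorem padicValInt_lucasU_mul_of_ne_two {a b : ℤ} {q : ℕ} (hq : q.Prime) (hq2 : q ≠ 2)
    (hqb : ¬ (q : ℤ) ∣ b) (ha : 0 < a) (hΔ : 0 < a ^ 2 + 4 * b) {r k : ℕ}
    (hr : 0 < r) (hk : 0 < k) (h : (q : ℤ) ^ 2 ∣ (a ^ 2 + 4 * b) * lucasU a b r ^ 2) :
    padicValInt q (lucasU a b (r * k)) = padicValInt q (lucasU a b r) + padicValNat q k := by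
  have := Fact.mk hq
  have hq' := Nat.prime_iff_prime_int.1 hq
  have hU := lucasU_pos ha hΔ hr
  have hb' : ¬ (q : ℤ) ∣ -(-b) ^ r := by
    rw [dvd_neg]
    intro h'
    exact hqb ((dvd_neg).1 (hq'.dvd_of_dvd_pow h'))
  have hV := lucasV_pos ha hΔ hr
  have hΔ' : 0 < lucasV a b r ^ 2 + 4 * (-(-b) ^ r) := by rw [discrim_lucasV]; positivity
  rw [lucasU_mul, padicValInt.mul hU.ne' (lucasU_pos hV hΔ' hk).ne',
    padicValInt_lucasU_of_sq_dvd_discrim hq hq2 hb' hV hΔ' (by rwa [discrim_lucasV]) k hk]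

theorem lucasV_emod_four {a b : ℤ} (ha : a % 4 = 2) (hb : b % 4 = 3) (k : ℕ) :
    lucasV a b k % 4 = 2 := by
  induction k using Nat.twoStepInduction with
  | zero => simp [lucasV_zero]
  | one => simpa [lucasV_one] using ha
  | more k h₁ h₂ =>
    rw [lucasV_add_two, Int.add_emod, Int.mul_emod, Int.mul_emod b, ha, hb, h₁, h₂]
    norm_num

theorem lucasU_emod_two {a b : ℤ} (ha : 2 ∣ a) (hb : ¬ 2 ∣ b) (k : ℕ) :
    lucasU a b k % 2 = k % 2 := by
  induction k using Nat.twoStepInduction with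
  | zero => simp [lucasU_zero]
  | one => simp [lucasU_one]
  | more k h₁ h₂ =>
    rw [lucasU_add_two, Int.add_emod, Int.mul_emod, Int.mul_emod b, h₁,
      Int.emod_eq_zero_of_dvd ha, Int.emod_two_ne_zero.1 (fun h => hb (Int.dvd_of_emod_eq_zero h))]
    push_cast
    omega

theorem padicValInt_two_eq_one {z : ℤ} (h : z % 4 = 2) : padicValInt 2 z = 1 := by
  have l1 : 1 ≤ padicValInt 2 z := by
    rcases (padicValInt_dvd_iff (p := 2) 1 z).1 (by norm_num; omega) with h' | h'
    · omega
    · exact h'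
  have l2 : ¬ 2 ≤ padicValInt 2 z := fun h' => by
    have := (padicValInt_dvd_iff (p := 2) 2 z).2 (Or.inr h')
    norm_num at this
    omega
  omega

theorem padicValInt_two_lucasU {a b : ℤ} (ha0 : 0 < a) (hΔ : 0 < a ^ 2 + 4 * b) (ha : a % 4 = 2)
    (hb : b % 4 = 3) (k : ℕ) (hk : 0 < k) : padicValInt 2 (lucasU a b k) = padicValNat 2 k := by
  induction k using Nat.strong_induction_on with
  | _ k ih =>
    by_cases h2 : 2 ∣ k
    · obtain ⟨j, rfl⟩ := h2
      have hj : 0 < j := by omega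
      rw [lucasU_two_mul, padicValInt.mul (lucasU_pos ha0 hΔ hj).ne' (lucasV_pos ha0 hΔ hj).ne',
        padicValInt_two_eq_one (lucasV_emod_four ha hb j), ih j (by omega) hj,
        padicValNat.mul two_ne_zero hj.ne', padicValNat_self, add_comm]
    · rw [padicValNat.eq_zero_of_not_dvd h2, padicValInt]
      apply padicValNat.eq_zero_of_not_dvd
      have := lucasU_emod_two (a := a) (b := b) (by omega) (by omega) k
      omega

theorem padicValInt_two_lucasU_mul {a b : ℤ} (ha : 0 < a) (hΔ : 0 < a ^ 2 + 4 * b)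
    (hb : ¬ 2 ∣ b) {r k : ℕ} (hr : 0 < r) (hr2 : 2 ∣ r) (hk : 0 < k)
    (h : 2 ∣ (a ^ 2 + 4 * b) * lucasU a b r) :
    padicValInt 2 (lucasU a b (r * k)) = padicValInt 2 (lucasU a b r) + padicValNat 2 k := by
  obtain ⟨s, rfl⟩ := hr2
  have hVs : 2 ∣ lucasV a b s := by
    refine Int.prime_two.dvd_of_dvd_pow (n := 2) ?_
    rw [lucasU_two_mul] at h
    have e := lucasV_sq a b s
    rcases Int.prime_two.dvd_or_dvd h with h | h
    · rw [e]
      exact dvd_add (h.mul_right _) ⟨2 * (-b) ^ s, by ring⟩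
    rcases Int.prime_two.dvd_or_dvd h with h | h
    · rw [e]
      exact dvd_add ((dvd_pow h two_ne_zero).mul_left _) ⟨2 * (-b) ^ s, by ring⟩
    · exact dvd_pow h two_ne_zero
  have hodd : Odd (-b) := by rw [odd_neg, ← Int.not_even_iff_odd, even_iff_two_dvd]; exact hb
  have hpow : Odd ((-b) ^ s) := hodd.pow
  have hV4 : lucasV a b (2 * s) % 4 = 2 := by
    rw [lucasV_two_mul]
    obtain ⟨c, hc⟩ := hVs
    obtain ⟨d, hd⟩ := hpow
    rw [hc, hd, show (2 * c) ^ 2 - 2 * (2 * d + 1) = 4 * (c ^ 2 - d - 1) + 2 by ring]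
    omega
  have hb4 : -(-b) ^ (2 * s) % 4 = 3 := by
    obtain ⟨d, hd⟩ := hpow
    rw [mul_comm 2 s, pow_mul, hd, show -(2 * d + 1) ^ 2 = 4 * (-d ^ 2 - d - 1) + 3 by ring]
    omega
  have hU := lucasU_pos ha hΔ hr
  have hV := lucasV_pos ha hΔ hr
  have hΔ' : 0 < lucasV a b (2 * s) ^ 2 + 4 * (-(-b) ^ (2 * s)) := by
    rw [discrim_lucasV]; positivity
  rw [lucasU_mul, padicValInt.mul hU.ne' (lucasU_pos hV hΔ' hk).ne',
    padicValInt_two_lucasU hV hΔ' hV4 hb4 k hk]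

theorem padicValInt_lucasU_mul {a b : ℤ} (ha : 0 < a) (hΔ : 0 < a ^ 2 + 4 * b) {q : ℕ}
    (hq : q.Prime) (hqb : ¬ (q : ℤ) ∣ b) {r k : ℕ} (hr : 0 < r) (hr2 : 2 ∣ r) (hk : 0 < k)
    (h : (q : ℤ) ^ 2 ∣ a ^ 2 + 4 * b ∨ (q : ℤ) ∣ lucasU a b r) :
    padicValInt q (lucasU a b (r * k)) = padicValInt q (lucasU a b r) + padicValNat q k := by
  by_cases hq2 : q = 2
  · subst hq2
    refine padicValInt_two_lucasU_mul ha hΔ (by exact_mod_cast hqb) hr hr2 hk ?_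
    rcases h with h | h
    · exact ((dvd_pow_self _ two_ne_zero).trans h).mul_right _
    · exact Dvd.dvd.mul_left h _
  · refine padicValInt_lucasU_mul_of_ne_two hq hq2 hqb ha hΔ hr hk ?_
    rcases h with h | h
    · exact h.mul_right _
    · exact Dvd.dvd.mul_left (pow_dvd_pow_of_dvd h 2) _

theorem nat_dvd_iff_padicValNat_le {m n : ℕ} (hm : m ≠ 0) (hn : n ≠ 0) :
    m ∣ n ↔ ∀ q : ℕ, q.Prime → padicValNat q m ≤ padicValNat q n := by
  rw [← Nat.factorization_prime_le_iff_dvd hm hn]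
  refine forall₂_congr fun q hq => ?_
  rw [Nat.factorization_def _ hq, Nat.factorization_def _ hq]

theorem int_dvd_iff_padicValInt_le {m n : ℤ} (hm : m ≠ 0) (hn : n ≠ 0) :
    m ∣ n ↔ ∀ q : ℕ, q.Prime → padicValInt q m ≤ padicValInt q n := by
  rw [← Int.natAbs_dvd_natAbs,
    nat_dvd_iff_padicValNat_le (Int.natAbs_ne_zero.2 hm) (Int.natAbs_ne_zero.2 hn)]
  rfl

theorem padicValInt_eq_zero_of_not_dvd {q : ℕ} {z : ℤ} (h : ¬ (q : ℤ) ∣ z) :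
    padicValInt q z = 0 := by
  rw [padicValInt]
  apply padicValNat.eq_zero_of_not_dvd
  rwa [← Int.natCast_dvd]

theorem padicValInt_pos_of_dvd {q : ℕ} (hq : q.Prime) {z : ℤ} (hz : z ≠ 0) (h : (q : ℤ) ∣ z) :
    0 < padicValInt q z := by
  have := Fact.mk hq
  rcases (padicValInt_dvd_iff 1 z).1 (by simpa using h) with h | h
  · exact absurd h hz
  · exact h

theorem gcd_eq_gcd_of_padicValNat {A m n : ℕ} (hA : A ≠ 0) (hm : m ≠ 0) (hn : n ≠ 0)
    (h : ∀ q : ℕ, q.Prime → q ∣ A → padicValNat q m = padicValNat q n) :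
    A.gcd m = A.gcd n := by
  have key : ∀ {m n : ℕ}, m ≠ 0 → n ≠ 0 →
      (∀ q : ℕ, q.Prime → q ∣ A → padicValNat q m = padicValNat q n) → A.gcd m ∣ A.gcd n := by
    intro m n hm hn h
    refine Nat.dvd_gcd (Nat.gcd_dvd_left _ _) ?_
    have hg : A.gcd m ≠ 0 := (Nat.gcd_pos_of_pos_left _ (Nat.pos_of_ne_zero hA)).ne'
    rw [nat_dvd_iff_padicValNat_le hg hn]
    intro q hq
    by_cases hqA : q ∣ A
    · rw [← h q hq hqA]
      exact (nat_dvd_iff_padicValNat_le hg hm).1 (Nat.gcd_dvd_right _ _) q hq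
    · rw [padicValNat.eq_zero_of_not_dvd fun h' => hqA (h'.trans (Nat.gcd_dvd_left _ _))]
      exact Nat.zero_le _
  exact Nat.dvd_antisymm (key hm hn h) (key hn hm fun q hq hA => (h q hq hA).symm)

theorem mul_sq_dvd_mul_iff {D e W j : ℕ} (he : e ≠ 0) (hDW : D.Coprime W) :
    D ^ 2 * e ∣ W * j ↔ D ^ 2 * (e / e.gcd W) ∣ j := by
  have hg : 0 < e.gcd W := Nat.gcd_pos_of_pos_left _ (Nat.pos_of_ne_zero he)
  obtain ⟨e', W', hco, he', hW'⟩ := Nat.exists_coprime e W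
  have hdiv : e / e.gcd W = e' := Nat.div_eq_of_eq_mul_left hg he'
  have hcop : (D ^ 2 * e').Coprime W' :=
    ((hDW.coprime_dvd_right ⟨e.gcd W, hW'⟩).pow_left 2).mul_left hco
  rw [hdiv]
  have h₁ : D ^ 2 * e = e.gcd W * (D ^ 2 * e') := by
    rw [mul_left_comm, mul_comm (e.gcd W) e', ← he']
  have h₂ : W * j = e.gcd W * (W' * j) := by
    rw [← mul_assoc, mul_comm (e.gcd W) W', ← hW']
  rw [h₁, h₂, Nat.mul_dvd_mul_iff_left hg]
  exact hcop.dvd_mul_left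

theorem not_dvd_of_sq_dvd_discrim_or {a b : ℤ} (hab : IsCoprime a b) {q : ℕ} (hq : q.Prime)
    {r : ℕ} (hr : 0 < r) (h : (q : ℤ) ^ 2 ∣ a ^ 2 + 4 * b ∨ (q : ℤ) ∣ lucasU a b r) :
    ¬ (q : ℤ) ∣ b := by
  have hq' := Nat.prime_iff_prime_int.1 hq
  intro hqb
  rcases h with h | h
  · have h1 : (q : ℤ) ∣ a ^ 2 + 4 * b := (dvd_pow_self _ two_ne_zero).trans h
    have h2 : (q : ℤ) ∣ a := hq'.dvd_of_dvd_pow ((dvd_add_left (hqb.mul_left 4)).1 h1)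
    exact hq'.not_isUnit (hab.isUnit_of_dvd' h2 hqb)
  · exact hq'.not_isUnit ((isCoprime_lucasU hab hr).isUnit_of_dvd' h hqb)

theorem dvd_lucasU_mul_iff {a b : ℤ} (hab : IsCoprime a b) (ha : 0 < a)
    (hΔ : 0 < a ^ 2 + 4 * b) {L j : ℕ} (hL : 0 < L) (hL2 : 2 ∣ L) (hj : 0 < j) {M : ℤ}
    (hM : M ≠ 0)
    (h : ∀ q : ℕ, q.Prime → (q : ℤ) ∣ M →
      (q : ℤ) ^ 2 ∣ a ^ 2 + 4 * b ∨ (q : ℤ) ∣ lucasU a b L) :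
    M ∣ lucasU a b (L * j) ↔ M ∣ lucasU a b L * j := by
  have hU := (lucasU_pos ha hΔ hL).ne'
  have hUj := (lucasU_pos ha hΔ (Nat.mul_pos hL hj)).ne'
  have hj0 : (j : ℤ) ≠ 0 := by exact_mod_cast hj.ne'
  rw [int_dvd_iff_padicValInt_le hM hUj, int_dvd_iff_padicValInt_le hM (mul_ne_zero hU hj0)]
  refine forall₂_congr fun q hq => ?_
  have := Fact.mk hq
  by_cases hqM : (q : ℤ) ∣ M
  · have hqb := not_dvd_of_sq_dvd_discrim_or hab hq hL (h q hq hqM)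
    rw [padicValInt_lucasU_mul ha hΔ hq hqb hL hL2 hj (h q hq hqM), padicValInt.mul hU hj0,
      padicValInt.of_nat]
  · simp [padicValInt_eq_zero_of_not_dvd hqM]

/-- If `M W = U_L e` with `L ∣ k` forced by `M ∣ U_k`, then the indices `k` with
`D ^ 2 M ∣ U_k` are the multiples of `L D ^ 2 e / gcd(e, W)`. -/
theorem sq_mul_dvd_lucasU_iff {a b : ℤ} (hab : IsCoprime a b) (ha : 0 < a)
    (hΔ : 0 < a ^ 2 + 4 * b) {L k : ℕ} (hL : 0 < L) (hL2 : 2 ∣ L) (hk : 0 < k) {M W e D : ℤ}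
    (hM : M ≠ 0) (he : e ≠ 0) (hD : D ≠ 0) (hMW : M * W = lucasU a b L * e)
    (hDΔ : D ^ 2 ∣ a ^ 2 + 4 * b)
    (hprime : ∀ q : ℕ, q.Prime → (q : ℤ) ∣ M → (q : ℤ) ∣ lucasU a b L)
    (hDW : IsCoprime D W) (hMk : M ∣ lucasU a b k → L ∣ k) :
    D ^ 2 * M ∣ lucasU a b k ↔ L * (D.natAbs ^ 2 * (e.natAbs / e.natAbs.gcd W.natAbs)) ∣ k := by
  by_cases hLk : L ∣ k
  · obtain ⟨j, rfl⟩ := hLk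
    have hj : 0 < j := Nat.pos_of_mul_pos_left hk
    rw [dvd_lucasU_mul_iff hab ha hΔ hL hL2 hj (mul_ne_zero (pow_ne_zero _ hD) hM),
      Nat.mul_dvd_mul_iff_left hL, ← mul_sq_dvd_mul_iff (Int.natAbs_ne_zero.2 he)
        (Int.isCoprime_iff_nat_coprime.1 hDW)]
    · rw [← mul_dvd_mul_iff_right he,
        show D ^ 2 * M * e = M * (D ^ 2 * e) by ring,
        show lucasU a b L * j * e = lucasU a b L * e * j by ring, ← hMW, mul_assoc M W,
        mul_dvd_mul_iff_left hM, ← Int.natAbs_dvd_natAbs]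
      simp [Int.natAbs_mul, Int.natAbs_pow]
    · intro q hq hqM
      rcases (Nat.prime_iff_prime_int.1 hq).dvd_or_dvd hqM with h | h
      · exact Or.inl ((pow_dvd_pow_of_dvd
          ((Nat.prime_iff_prime_int.1 hq).dvd_of_dvd_pow h) 2).trans hDΔ)
      · exact Or.inr (hprime q hq h)
  · exact iff_of_false (fun h => hLk (hMk ((dvd_mul_left _ _).trans h)))
      (fun h => hLk ((dvd_mul_right _ _).trans h))

theorem isCoprime_of_forall_nat_prime {x y : ℤ}
    (h : ∀ q : ℕ, q.Prime → (q : ℤ) ∣ x → ¬ (q : ℤ) ∣ y) : IsCoprime x y := by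
  rw [Int.isCoprime_iff_nat_coprime]
  refine Nat.Coprime.symm (Nat.coprime_of_dvd ?_)
  intro q hq hy hx
  exact h q hq (Int.natCast_dvd.2 hx) (Int.natCast_dvd.2 hy)

theorem prime_dvd_of_dvd_triple {x y z u : ℤ} (hx : x ∣ u) (hy : y ∣ u) (hz : z ∣ u) {q : ℕ}
    (hq : q.Prime) (h : (q : ℤ) ∣ x * y * z) : (q : ℤ) ∣ u := by
  have hq' := Nat.prime_iff_prime_int.1 hq
  rcases hq'.dvd_or_dvd h with h | h
  · rcases hq'.dvd_or_dvd h with h | h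
    · exact h.trans hx
    · exact h.trans hy
  · exact h.trans hz

theorem sq_mul_dvd_lucasU_iff_of_odd {a b : ℤ} (hab : IsCoprime a b) (hb : b ≠ 0) (ha : 0 < a)
    (hΔ : 0 < a ^ 2 + 4 * b) {n c : ℕ} (hn : ¬ 2 ∣ n) (hc : ¬ 2 ∣ c) (hnc : n.Coprime c)
    (hne : n + c ≠ 2 ∨ 1 < a) {D : ℤ} (hD : D ≠ 0) (hDΔ : D ^ 2 ∣ a ^ 2 + 4 * b) {k : ℕ}
    (hk : 0 < k) :
    D ^ 2 * (lucasU a b n * lucasU a b (n + c) * lucasU a b (n + 2 * c)) ∣ lucasU a b k ↔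
      n * (n + c) * (n + 2 * c) * D.natAbs ^ 2 ∣ k := by
  have hn0 : 0 < n := by omega
  have hy0 : 0 < n + c := by omega
  have hz0 : 0 < n + 2 * c := by omega
  have hL : 0 < n * (n + c) * (n + 2 * c) := by positivity
  have cxy : n.Coprime (n + c) := by simpa using hnc
  have cxz : n.Coprime (n + 2 * c) := by
    have h2 : n.Coprime 2 := ((Nat.Prime.coprime_iff_not_dvd Nat.prime_two).2 hn).symm
    simpa using h2.mul_right hnc
  have cyz : (n + c).Coprime (n + 2 * c) := by
    rw [show n + 2 * c = (n + c) + c by ring]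
    simpa using hnc
  have cxyz : (n * (n + c)).Coprime (n + 2 * c) := cxz.mul_left cyz
  have hx := lucasU_pos ha hΔ hn0
  have hy := lucasU_pos ha hΔ hy0
  have hz := lucasU_pos ha hΔ hz0
  have hU := lucasU_pos ha hΔ hL
  have dx : lucasU a b n ∣ lucasU a b (n * (n + c) * (n + 2 * c)) :=
    lucasU_dvd_of_dvd a b ((dvd_mul_right _ _).mul_right _)
  have dy : lucasU a b (n + c) ∣ lucasU a b (n * (n + c) * (n + 2 * c)) :=
    lucasU_dvd_of_dvd a b ((dvd_mul_left _ _).mul_right _)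
  have dz : lucasU a b (n + 2 * c) ∣ lucasU a b (n * (n + c) * (n + 2 * c)) :=
    lucasU_dvd_of_dvd a b (dvd_mul_left _ _)
  have hdvd : lucasU a b n * lucasU a b (n + c) * lucasU a b (n + 2 * c) ∣
      lucasU a b (n * (n + c) * (n + 2 * c)) :=
    ((isCoprime_lucasU_of_coprime hab cxz).mul_left (isCoprime_lucasU_of_coprime hab cyz)).mul_dvd
      ((isCoprime_lucasU_of_coprime hab cxy).mul_dvd dx dy) dz
  obtain ⟨W, hW⟩ := hdvd
  have hW0 : W ≠ 0 := by
    rintro rfl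
    rw [mul_zero] at hW
    exact hU.ne' hW
  have hDW : IsCoprime D W := by
    refine isCoprime_of_forall_nat_prime fun q hq hqD hqW => ?_
    have := Fact.mk hq
    have hqΔ : (q : ℤ) ^ 2 ∣ a ^ 2 + 4 * b := (pow_dvd_pow_of_dvd hqD 2).trans hDΔ
    have hqb := not_dvd_of_sq_dvd_discrim_or hab hq one_pos (Or.inl hqΔ)
    have hv := congrArg (padicValInt q) hW
    rw [padicValInt.mul (by positivity) hW0, padicValInt.mul (by positivity) hz.ne',
      padicValInt.mul hx.ne' hy.ne'] at hv
    have hpos := padicValInt_pos_of_dvd hq hW0 hqW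
    by_cases hq2 : q = 2
    · subst hq2
      rw [show n * (n + c) * (n + 2 * c) = (n + c) * (n * (n + 2 * c)) by ring,
        padicValInt_lucasU_mul ha hΔ hq hqb hy0 (by omega) (by positivity) (Or.inl hqΔ),
        padicValNat.mul hn0.ne' hz0.ne', padicValNat.eq_zero_of_not_dvd hn,
        padicValNat.eq_zero_of_not_dvd (show ¬ 2 ∣ n + 2 * c by omega)] at hv
      omega
    · have key := padicValInt_lucasU_of_sq_dvd_discrim hq hq2 hqb ha hΔ hqΔ
      rw [key _ hL, key _ hn0, key _ hy0, key _ hz0, padicValNat.mul (by positivity) hz0.ne',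
        padicValNat.mul hn0.ne' hy0.ne'] at hv
      omega
  have := sq_mul_dvd_lucasU_iff hab ha hΔ hL ?_ hk (by positivity) one_ne_zero hD
    (W := W) (M := lucasU a b n * lucasU a b (n + c) * lucasU a b (n + 2 * c))
    (by rw [mul_one, ← hW]) hDΔ (fun q hq h => prime_dvd_of_dvd_triple dx dy dz hq h) hDW ?_
  · simpa using this
  · exact (Dvd.dvd.mul_left (by omega) _).mul_right _
  · intro h
    refine cxyz.mul_dvd_of_dvd_of_dvd (cxy.mul_dvd_of_dvd_of_dvd ?_ ?_) ?_
    · exact dvd_of_lucasU_dvd hab hb ha hΔ hn0 (by omega)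
        (((dvd_mul_right _ _).mul_right _).trans h)
    · exact dvd_of_lucasU_dvd hab hb ha hΔ hy0 hne (((dvd_mul_left _ _).mul_right _).trans h)
    · exact dvd_of_lucasU_dvd hab hb ha hΔ hz0 (by omega) ((dvd_mul_left _ _).trans h)

theorem mul_dvd_mul_of_gcd_dvd {x z u e : ℤ} (hx : x ∣ u) (hz : z ∣ u)
    (he : (Int.gcd x z : ℤ) ∣ e) : x * z ∣ u * e := by
  have h : ((Int.gcd x z * Int.lcm x z : ℕ) : ℤ) ∣ u * e := by
    push_cast
    rw [mul_comm u]
    exact mul_dvd_mul he (Int.coe_lcm_dvd hx hz)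
  rw [Int.gcd_mul_lcm, ← Int.natAbs_mul, Int.natAbs_dvd] at h
  exact h

theorem sq_mul_dvd_lucasU_iff_of_even {a b : ℤ} (hab : IsCoprime a b) (hb : b ≠ 0) (ha : 0 < a)
    (hΔ : 0 < a ^ 2 + 4 * b) {h c : ℕ} (hh : 0 < h) (hc : ¬ 2 ∣ c) (hnc : h.Coprime c)
    {D : ℤ} (hD : D ≠ 0) (hDΔ : D ^ 2 ∣ a ^ 2 + 4 * b) {k : ℕ}
    (hk : 0 < k) :
    D ^ 2 * (lucasU a b (2 * h) * lucasU a b (2 * h + c) * lucasU a b (2 * h + 2 * c)) ∣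
        lucasU a b k ↔
      h * (2 * h + 2 * c) * (2 * h + c) *
        (D.natAbs ^ 2 * (a.natAbs / a.natAbs.gcd (2 * h + c))) ∣ k := by
  have hx0 : 0 < 2 * h := by omega
  have hy0 : 0 < 2 * h + c := by omega
  have hz0 : 0 < 2 * h + 2 * c := by omega
  have hhc : 0 < h + c := by omega
  have hL : 0 < h * (2 * h + 2 * c) * (2 * h + c) := by positivity
  have c2 : Nat.Coprime 2 c := (Nat.Prime.coprime_iff_not_dvd Nat.prime_two).2 hc
  have cxy : (2 * h).Coprime (2 * h + c) := by simpa using c2.mul_left hnc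
  have cyz : (2 * h + 2 * c).Coprime (2 * h + c) := by
    rw [show 2 * h + 2 * c = c + (2 * h + c) by ring, Nat.coprime_add_self_left,
      Nat.coprime_add_self_right]
    exact (c2.mul_left hnc).symm
  have chz : h.Coprime (h + c) := by simpa using hnc
  have gxz : (2 * h).gcd (2 * h + 2 * c) = 2 := by
    rw [← mul_add, Nat.gcd_mul_left, chz.gcd_eq_one, mul_one]
  have c2y : Nat.Coprime 2 (2 * h + c) := by simpa using c2
  have dLx : 2 * h ∣ h * (2 * h + 2 * c) * (2 * h + c) :=
    ⟨(h + c) * (2 * h + c), by ring⟩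
  have dLz : 2 * h + 2 * c ∣ h * (2 * h + 2 * c) * (2 * h + c) := ⟨h * (2 * h + c), by ring⟩
  have dLy : 2 * h + c ∣ h * (2 * h + 2 * c) * (2 * h + c) := dvd_mul_left _ _
  have hx := lucasU_pos ha hΔ hx0
  have hy := lucasU_pos ha hΔ hy0
  have hz := lucasU_pos ha hΔ hz0
  have hU := lucasU_pos ha hΔ hL
  have dx := lucasU_dvd_of_dvd a b dLx
  have dy := lucasU_dvd_of_dvd a b dLy
  have dz := lucasU_dvd_of_dvd a b dLz
  have hdvd : lucasU a b (2 * h) * lucasU a b (2 * h + c) * lucasU a b (2 * h + 2 * c) ∣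
      lucasU a b (h * (2 * h + 2 * c) * (2 * h + c)) * a := by
    rw [mul_right_comm]
    refine ((isCoprime_lucasU_of_coprime hab cxy).mul_left
      (isCoprime_lucasU_of_coprime hab cyz)).mul_dvd (mul_dvd_mul_of_gcd_dvd dx dz ?_)
      (dy.mul_right _)
    have := dvd_lucasU_gcd hab (2 * h) (2 * h + 2 * c)
      (Int.gcd_dvd_left (lucasU a b (2 * h)) (lucasU a b (2 * h + 2 * c))) (Int.gcd_dvd_right _ _)
    rwa [gxz, lucasU_two] at this
  obtain ⟨W, hW⟩ := hdvd
  have hW0 : W ≠ 0 := by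
    rintro rfl
    rw [mul_zero] at hW
    exact (mul_pos hU ha).ne' hW
  have hval : ∀ q : ℕ, q.Prime →
      padicValInt q (lucasU a b (h * (2 * h + 2 * c) * (2 * h + c))) + padicValInt q a =
      padicValInt q (lucasU a b (2 * h)) + padicValInt q (lucasU a b (2 * h + c)) +
        padicValInt q (lucasU a b (2 * h + 2 * c)) + padicValInt q W := by
    intro q hq
    have := Fact.mk hq
    have hv := congrArg (padicValInt q) hW
    rwa [padicValInt.mul (by positivity) hW0, padicValInt.mul (by positivity) hz.ne',
      padicValInt.mul hx.ne' hy.ne', padicValInt.mul hU.ne' ha.ne'] at hv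
  have hvW : ∀ q : ℕ, q.Prime → (q : ℤ) ∣ a → padicValInt q W = padicValNat q (2 * h + c) := by
    intro q hq hqa
    have := Fact.mk hq
    have hv := hval q hq
    have hqU : (q : ℤ) ∣ lucasU a b 2 := by rwa [lucasU_two]
    have hqb := not_dvd_of_sq_dvd_discrim_or hab hq two_pos (Or.inr hqU)
    have hqy : ¬ (q : ℤ) ∣ lucasU a b (2 * h + c) := fun h' =>
      (Nat.prime_iff_prime_int.1 hq).not_isUnit
        ((isCoprime_lucasU_of_coprime hab c2y).isUnit_of_dvd' hqU h')
    have key : ∀ i : ℕ, 0 < i →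
        padicValInt q (lucasU a b (2 * i)) = padicValInt q a + padicValNat q i := by
      intro i hi
      rw [padicValInt_lucasU_mul ha hΔ hq hqb two_pos dvd_rfl hi (Or.inr hqU), lucasU_two]
    rw [padicValInt_eq_zero_of_not_dvd hqy,
      show h * (2 * h + 2 * c) * (2 * h + c) = 2 * (h * (h + c) * (2 * h + c)) by ring, ← mul_add,
      key _ (by positivity), key _ hh, key _ hhc, padicValNat.mul (by positivity) hy0.ne',
      padicValNat.mul hh.ne' hhc.ne'] at hv
    omega
  have hDW : IsCoprime D W := by
    refine isCoprime_of_forall_nat_prime fun q hq hqD hqW => ?_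
    have := Fact.mk hq
    have hqΔ : (q : ℤ) ^ 2 ∣ a ^ 2 + 4 * b := (pow_dvd_pow_of_dvd hqD 2).trans hDΔ
    have hqΔ1 : (q : ℤ) ∣ a ^ 2 + 4 * b := (dvd_pow_self _ two_ne_zero).trans hqΔ
    have hqb := not_dvd_of_sq_dvd_discrim_or hab hq one_pos (Or.inl hqΔ)
    have hpos := padicValInt_pos_of_dvd hq hW0 hqW
    by_cases hq2 : q = 2
    · subst hq2
      have h2a : ((2 : ℕ) : ℤ) ∣ a := by
        refine Int.prime_two.dvd_of_dvd_pow (n := 2) ?_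
        exact (dvd_add_left (⟨2 * b, by ring⟩ : (2 : ℤ) ∣ 4 * b)).1 hqΔ1
      rw [hvW 2 hq h2a, padicValNat.eq_zero_of_not_dvd (by omega)] at hpos
      exact lt_irrefl _ hpos
    · have hv := hval q hq
      have key := padicValInt_lucasU_of_sq_dvd_discrim hq hq2 hqb ha hΔ hqΔ
      have h2 : padicValNat q 2 = 0 := padicValNat.eq_zero_of_not_dvd fun h' =>
        hq2 ((Nat.prime_dvd_prime_iff_eq hq Nat.prime_two).1 h')
      rw [key _ hL, key _ hx0, key _ hy0, key _ hz0, padicValNat.mul (by positivity) hy0.ne',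
        padicValNat.mul hh.ne' hz0.ne', padicValNat.mul two_ne_zero hh.ne', h2,
        padicValInt_eq_zero_of_not_dvd (not_dvd_of_dvd_discrim hq hq2 hqb hqΔ1)] at hv
      omega
  have hgcd : a.natAbs.gcd W.natAbs = a.natAbs.gcd (2 * h + c) :=
    gcd_eq_gcd_of_padicValNat (Int.natAbs_ne_zero.2 ha.ne') (Int.natAbs_ne_zero.2 hW0) hy0.ne'
      fun q hq hqa => hvW q hq (Int.natCast_dvd.2 hqa)
  rw [← hgcd]
  refine sq_mul_dvd_lucasU_iff hab ha hΔ hL (Dvd.intro _ rfl |>.trans dLx) hk (by positivity)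
    ha.ne' hD hW.symm hDΔ (fun q hq h => prime_dvd_of_dvd_triple dx dy dz hq h) hDW ?_
  intro hM
  have kz : 2 * h + 2 * c ∣ k :=
    dvd_of_lucasU_dvd hab hb ha hΔ hz0 (by omega) ((dvd_mul_left _ _).trans hM)
  have ky : 2 * h + c ∣ k :=
    dvd_of_lucasU_dvd hab hb ha hΔ hy0 (by omega) (((dvd_mul_left _ _).mul_right _).trans hM)
  have k2 : 2 ∣ k := (Dvd.intro (h + c) (by ring)).trans kz
  have kx : 2 * h ∣ k := by
    by_cases h2 : 2 * h = 2
    · rwa [h2]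
    · exact dvd_of_lucasU_dvd hab hb ha hΔ hx0 (Or.inl h2)
        (((dvd_mul_right _ _).mul_right _).trans hM)
  obtain ⟨i, rfl⟩ := k2
  refine Nat.Coprime.mul_dvd_of_dvd_of_dvd ?_ ?_ ky
  · exact (cxy.coprime_dvd_left (dvd_mul_left _ _)).mul_left cyz
  · rw [← mul_add] at kz
    rw [show h * (2 * h + 2 * c) = 2 * (h * (h + c)) by ring]
    exact mul_dvd_mul_left 2 (chz.mul_dvd_of_dvd_of_dvd
      ((Nat.mul_dvd_mul_iff_left two_pos).1 kx) ((Nat.mul_dvd_mul_iff_left two_pos).1 kz))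

theorem isLeast_appearanceSet {a b m : ℤ} {T : ℕ} (hT : 0 < T)
    (h : ∀ k : ℕ, 0 < k → (m ∣ lucasU a b k ↔ T ∣ k)) : IsLeast (appearanceSet a b m) T :=
  ⟨⟨hT, (h T hT).2 dvd_rfl⟩, fun k hk => Nat.le_of_dvd hk.1 ((h k hk.1).1 hk.2)⟩

theorem orderOfAppearance_eq {a b m : ℤ} {T : ℕ} (h : IsLeast (appearanceSet a b m) T) :
    orderOfAppearance a b m = T := h.csInf_eq

theorem dvd_lucasU_iff_of_index_dvd {a b : ℤ} (hab : IsCoprime a b) (hb : b ≠ 0) (ha : 0 < a)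
    (hΔ : 0 < a ^ 2 + 4 * b) {p : ℕ} (hp : 3 ≤ p) {T : ℕ} {x y z : ℤ}
    (h : ∀ j : ℕ, 0 < j → (lucasU a b p ^ 2 * (x * y * z) ∣
      lucasU (lucasV a b p) (-(-b) ^ p) j ↔ T ∣ j)) {k : ℕ} (hk : 0 < k) :
    lucasU a b p * x * (lucasU a b p * y) * (lucasU a b p * z) ∣ lucasU a b k ↔ p * T ∣ k := by
  have hU := lucasU_pos ha hΔ (show 0 < p by omega)
  by_cases hpk : p ∣ k
  · obtain ⟨j, rfl⟩ := hpk
    rw [Nat.mul_dvd_mul_iff_left (by omega), ← h j (Nat.pos_of_mul_pos_left hk), lucasU_mul,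
      show lucasU a b p * x * (lucasU a b p * y) * (lucasU a b p * z) =
        lucasU a b p * (lucasU a b p ^ 2 * (x * y * z)) by ring, mul_dvd_mul_iff_left hU.ne']
  · refine iff_of_false (fun h' => hpk ?_) (fun h' => hpk ((dvd_mul_right _ _).trans h'))
    refine dvd_of_lucasU_dvd hab hb ha hΔ (by omega) (by omega) (Dvd.dvd.trans ?_ h')
    exact ⟨x * (lucasU a b p * y) * (lucasU a b p * z), by ring⟩

theorem isCoprime_lucasV_neg_pow {a b : ℤ} (hab : IsCoprime a b) {p : ℕ} (hp : 0 < p) :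
    IsCoprime (lucasV a b p) (-(-b) ^ p) :=
  ((isCoprime_lucasV hab hp).neg_right.pow_right).neg_right

theorem theorem1p2 (a b : ℤ) (hab : IsCoprime a b) (hb : b ≠ 0) (ha : 0 < a)
    (hΔ : 0 < a ^ 2 + 4 * b) (n p : ℕ) (hn : 0 < n) (hp : p.Prime) (hp3 : 3 ≤ p) :
    -- `m = U_n U_{n+p} U_{n+2p}` is positive and prime to `b`, and the minimum `τ(m)` is attained
    0 < lucasU a b n * lucasU a b (n + p) * lucasU a b (n + 2 * p) ∧
    IsCoprime (lucasU a b n * lucasU a b (n + p) * lucasU a b (n + 2 * p)) b ∧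
    IsLeast (appearanceSet a b (lucasU a b n * lucasU a b (n + p) * lucasU a b (n + 2 * p)))
      (orderOfAppearance a b (lucasU a b n * lucasU a b (n + p) * lucasU a b (n + 2 * p))) ∧
    -- the four cases, with all divisions taken in `ℚ`, except `(n + p) / p`, which is exact
    (¬ p ∣ n → ¬ 2 ∣ n →
      (orderOfAppearance a b
          (lucasU a b n * lucasU a b (n + p) * lucasU a b (n + 2 * p)) : ℚ) =
        n * (n + p) * (n + 2 * p)) ∧
    (¬ p ∣ n → 2 ∣ n →
      (orderOfAppearance a b
          (lucasU a b n * lucasU a b (n + p) * lucasU a b (n + 2 * p)) : ℚ) =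
        (n * (n + p) * (n + 2 * p)) / 2 * (a / Int.gcd a ((n + p : ℕ) : ℤ))) ∧
    (p ∣ n → ¬ 2 ∣ n →
      (orderOfAppearance a b
          (lucasU a b n * lucasU a b (n + p) * lucasU a b (n + 2 * p)) : ℚ) =
        (n * (n + p) * (n + 2 * p)) / p ^ 2 * lucasU a b p ^ 2) ∧
    (p ∣ n → 2 ∣ n →
      (orderOfAppearance a b
          (lucasU a b n * lucasU a b (n + p) * lucasU a b (n + 2 * p)) : ℚ) =
        (n * (n + p) * (n + 2 * p)) / (2 * p ^ 2) *
          ((lucasU a b p ^ 2 * lucasV a b p) /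
            Int.gcd (lucasV a b p) (((n + p) / p : ℕ) : ℤ))) := by
  have hx := lucasU_pos ha hΔ hn
  have hy := lucasU_pos ha hΔ (show 0 < n + p by omega)
  have hz := lucasU_pos ha hΔ (show 0 < n + 2 * p by omega)
  refine ⟨by positivity, ((isCoprime_lucasU hab hn).mul_left
    (isCoprime_lucasU hab (by omega))).mul_left (isCoprime_lucasU hab (by omega)), ?_⟩
  suffices H : ∃ T : ℕ, 0 < T ∧
      (∀ k : ℕ, 0 < k → (lucasU a b n * lucasU a b (n + p) * lucasU a b (n + 2 * p) ∣
        lucasU a b k ↔ T ∣ k)) ∧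
      (¬ p ∣ n → ¬ 2 ∣ n → (T : ℚ) = n * (n + p) * (n + 2 * p)) ∧
      (¬ p ∣ n → 2 ∣ n → (T : ℚ) =
        (n * (n + p) * (n + 2 * p)) / 2 * (a / Int.gcd a ((n + p : ℕ) : ℤ))) ∧
      (p ∣ n → ¬ 2 ∣ n → (T : ℚ) =
        (n * (n + p) * (n + 2 * p)) / p ^ 2 * lucasU a b p ^ 2) ∧
      (p ∣ n → 2 ∣ n → (T : ℚ) =
        (n * (n + p) * (n + 2 * p)) / (2 * p ^ 2) *
          ((lucasU a b p ^ 2 * lucasV a b p) /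
            Int.gcd (lucasV a b p) (((n + p) / p : ℕ) : ℤ))) by
    obtain ⟨T, hT, hdvd, hcases⟩ := H
    have hleast := isLeast_appearanceSet hT hdvd
    rw [orderOfAppearance_eq hleast]
    exact ⟨hleast, hcases⟩
  have hp0 : 0 < p := hp.pos
  have hpodd : ¬ 2 ∣ p := fun h =>
    absurd ((Nat.prime_dvd_prime_iff_eq Nat.prime_two hp).1 h) (by omega)
  by_cases hpn : p ∣ n
  · obtain ⟨m, rfl⟩ := hpn
    have hm : 0 < m := Nat.pos_of_mul_pos_left hn
    have hU := lucasU_pos ha hΔ hp0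
    have hV := lucasV_pos ha hΔ hp0
    have hV1 := one_lt_lucasV hb ha hΔ (show 2 ≤ p by omega)
    have hΔ' : 0 < lucasV a b p ^ 2 + 4 * (-(-b) ^ p) := by rw [discrim_lucasV]; positivity
    have hab' := isCoprime_lucasV_neg_pow hab hp0
    have hb' : -(-b) ^ p ≠ 0 := neg_ne_zero.2 (pow_ne_zero _ (neg_ne_zero.2 hb))
    have hDΔ : lucasU a b p ^ 2 ∣ lucasV a b p ^ 2 + 4 * (-(-b) ^ p) := by
      rw [discrim_lucasV]; exact dvd_mul_left _ _
    have hUabs : ((lucasU a b p).natAbs : ℚ) = lucasU a b p := by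
      rw [Nat.cast_natAbs, abs_of_pos hU]
    have hp' : (p : ℚ) ≠ 0 := by exact_mod_cast hp0.ne'
    rw [show p * m + p = p * (m + 1) by ring, show p * m + 2 * p = p * (m + 2 * 1) by ring,
      lucasU_mul a b p m, lucasU_mul a b p (m + 1), lucasU_mul a b p (m + 2 * 1)]
    by_cases h2 : 2 ∣ m
    · obtain ⟨h, rfl⟩ := h2
      have hh : 0 < h := by omega
      have hg : 0 < (lucasV a b p).natAbs.gcd (2 * h + 1) := Nat.gcd_pos_of_pos_right _ (by omega)
      have hgd : (lucasV a b p).natAbs.gcd (2 * h + 1) ∣ (lucasV a b p).natAbs :=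
        Nat.gcd_dvd_left _ _
      refine ⟨_, ?_, fun k hk => dvd_lucasU_iff_of_index_dvd hab hb ha hΔ hp3
        (fun j hj => sq_mul_dvd_lucasU_iff_of_even hab' hb' hV hΔ' hh (by norm_num)
          (Nat.coprime_one_right h) hU.ne' hDΔ hj) hk, ?_, ?_, ?_, ?_⟩
      · have := Nat.div_pos (Nat.le_of_dvd (Int.natAbs_pos.2 hV.ne') hgd) hg
        have := Int.natAbs_pos.2 hU.ne'
        positivity
      · exact fun h' => absurd (dvd_mul_right _ _) h'
      · exact fun h' => absurd (dvd_mul_right _ _) h'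
      · exact fun _ h' => absurd (Dvd.intro_left (p * h) (by ring)) h'
      · intro _ _
        rw [Nat.mul_div_cancel_left _ hp0, Int.gcd_def, Int.natAbs_natCast]
        have hVabs : ((lucasV a b p).natAbs : ℚ) = lucasV a b p := by
          rw [Nat.cast_natAbs, abs_of_pos hV]
        push_cast [Nat.cast_div_charZero hgd]
        rw [hUabs, hVabs]
        field_simp
    · refine ⟨_, ?_, fun k hk => dvd_lucasU_iff_of_index_dvd hab hb ha hΔ hp3
        (fun j hj => sq_mul_dvd_lucasU_iff_of_odd hab' hb' hV hΔ' h2 (by norm_num)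
          (Nat.coprime_one_right m) (Or.inr hV1) hU.ne' hDΔ hj) hk, ?_, ?_, ?_, ?_⟩
      · have := Int.natAbs_pos.2 hU.ne'
        positivity
      · exact fun h' => absurd (dvd_mul_right _ _) h'
      · exact fun h' => absurd (dvd_mul_right _ _) h'
      · intro _ _
        push_cast
        rw [hUabs]
        field_simp
      · exact fun _ h' => absurd ((Nat.Prime.dvd_mul Nat.prime_two).1 h') (by tauto)
  · have hnp : n.Coprime p := ((Nat.Prime.coprime_iff_not_dvd hp).2 hpn).symm
    by_cases h2 : 2 ∣ n
    · obtain ⟨h, rfl⟩ := h2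
      have hh : 0 < h := by omega
      have hg : 0 < a.natAbs.gcd (2 * h + p) := Nat.gcd_pos_of_pos_right _ (by omega)
      have hgd : a.natAbs.gcd (2 * h + p) ∣ a.natAbs := Nat.gcd_dvd_left _ _
      refine ⟨_, ?_, fun k hk => by
        simpa only [one_pow, one_mul] using sq_mul_dvd_lucasU_iff_of_even hab hb ha hΔ hh hpodd
          (hnp.coprime_dvd_left (dvd_mul_left _ _)) one_ne_zero (by simp) hk, ?_, ?_, ?_, ?_⟩
      · have := Nat.div_pos (Nat.le_of_dvd (Int.natAbs_pos.2 ha.ne') hgd) hg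
        simp only [Int.natAbs_one]
        positivity
      · exact fun _ h' => absurd (dvd_mul_right _ _) h'
      · intro _ _
        rw [Int.gcd_def, Int.natAbs_natCast]
        have haabs : (a.natAbs : ℚ) = a := by
          rw [Nat.cast_natAbs, abs_of_pos ha]
        push_cast [Nat.cast_div_charZero hgd, Int.natAbs_one]
        rw [haabs]
        field_simp
      · exact fun h' => absurd h' hpn
      · exact fun h' => absurd h' hpn
    · refine ⟨_, ?_, fun k hk => by
        simpa only [one_pow, one_mul] using sq_mul_dvd_lucasU_iff_of_odd hab hb ha hΔ h2 hpodd
          hnp (by omega) one_ne_zero (by simp) hk, ?_, ?_, ?_, ?_⟩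
      · simp only [Int.natAbs_one]
        positivity
      · intro _ _
        simp
      · exact fun _ h' => absurd h' h2
      · exact fun h' => absurd h' hpn
      · exact fun h' => absurd h' hpn
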